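/- Let $I$ be a non-empty finite set and $(\alpha_i)_{i\in I}$ the standard basis of $\mathbb Z^I$. A \emph{generalized Cartan matrix} is a matrix $(c_{ij})\in\mathbb Z^{I\times I}$ with $c_{ii}=2$ for all $i$, $c_{jk}\le 0$ for $j\ne k$, and $c_{ij}=0\Rightarrow c_{ji}=0$. A \emph{Cartan scheme} $\mathcal C=\mathcal C(I,A,(\rho_i)_{i\in I},(C^a)_{a\in A})$ consists of a non-empty set $A$, maps $\rho_i:A\to A$ and generalized Cartan matrices $C^a=(c^a_{jk})_{j,k\in I}$ such that $\rho_i^2=\mathrm{id}$ and $c^{\rho_i(a)}_{ij}=c^a_{ij}$ for all $i,j\in I$, $a\in A$. For $i\in I$, $a\in A$ let $\sigma_i^a\in\mathrm{Aut}(\mathbb Z^I)$ be given by $\sigma_i^a(\alpha_j)=\alpha_j-c^a_{ij}\alpha_i$ for all $j\in I$. For $a,b\in A$ let $\mathrm{Hom}(a,b)$ be the set of all triples $(b,f,a)$ with $$f=\sigma_{i_n}^{\rho_{i_{n-1}}\cdots\rho_{i_1}(a)}\cdots\sigma_{i_2}^{\rho_{i_1}(a)}\sigma_{i_1}^a,\qquad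 b=\rho_{i_n}\cdots\rho_{i_1}(a)$$ for some $n\ge 0$ and $i_1,\dots,i_n\in I$. The scheme $\mathcal C$ is \emph{connected} if $\mathrm{Hom}(a,b)\neq\emptyset$ for all $a,b\in A$, and it \emph{satisfies (C3)} if $(b,\mathrm{id},a)\in\mathrm{Hom}(a,b)$ implies $a=b$. A \emph{root system of type} $\mathcal C$ is a family $(R^a)_{a\in A}$ of subsets of $\mathbb Z^I$ such that, with $R^a_+=R^a\cap\mathbb N_0^I$ and $m^a_{i,j}=|R^a\cap(\mathbb N_0\alpha_i+\mathbb N_0\alpha_j)|$, for all $a\in A$ and $i,j\in I$: (R1) $R^a=R^a_+\cup -R^a_+$; (R2) $R^a\cap\mathbb Z\alpha_i=\{\alpha_i,-\alpha_i\}$; (R3) $\sigma_i^a(R^a)=R^{\rho_i(a)}$; (R4) if $i\ne j$ and $m^a_{i,j}$ is finite, then $(\rho_i\rho_j)^{m^a_{i,j}}(a)=a$. Let $\mathcal C=\mathcal C(I,A,(\rho_i)_{i\in I},(C^a)_{a\in A})$ and $\mathcal C'=\mathcal C'(I,A',(\rho'_i)_{i\in I},(C'^{a})_{a\in A'})$ be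 connected Cartan schemes, and let $\pi:\mathcal C'\to\mathcal C$ be a covering, that is, a map $\pi:A'\to A$ with $C^{\pi(a')}=C'^{a'}$ and $\pi(\rho'_i(a'))=\rho_i(\pi(a'))$ for all $a'\in A'$, $i\in I$. (1) If $(R'^{a'})_{a'\in A'}$ is a root system of type $\mathcal C'$, then the sets $$R^a=\bigcap_{a'\in A',\ \pi(a')=a}R'^{a'}\qquad (a\in A)$$ form a root system of type $\mathcal C$. (2) If $(R^a)_{a\in A}$ is a root system of type $\mathcal C$ and $\mathcal C'$ satisfies (C3), then the sets $R'^{a'}=R^{\pi(a')}$ $(a'\in A')$ form a root system of type $\mathcal C'$. -/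

import Mathlib

open scoped Pointwise

/-- Generalized Cartan matrices, indexed by `I`. -/
structure IsGeneralizedCartanMatrix {I : Type*} (c : Matrix I I ℤ) : Prop where
  diag : ∀ i, c i i = 2
  nonpos : ∀ j k, j ≠ k → c j k ≤ 0
  zero_symm : ∀ i j, c i j = 0 → c j i = 0

/-- A Cartan scheme with index set `I` and (non-empty) set of objects `A`. -/
structure CartanScheme (I A : Type*) where
  nonempty_obj : Nonempty A
  /-- the maps `ρ_i : A → A` -/
  rho : I → A → A
  /-- the generalized Cartan matrices `C^a` -/
  cartan : A → Matrix I I ℤ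
  isGCM : ∀ a, IsGeneralizedCartanMatrix (cartan a)
  rho_rho : ∀ i a, rho i (rho i a) = a
  cartan_rho : ∀ a i j, cartan (rho i a) i j = cartan a i j

/-- The standard basis vector `α_i` of `ℤ^I`. -/
def simpleRoot {I : Type*} [DecidableEq I] (i : I) : I → ℤ := Pi.single i 1

namespace CartanScheme

variable {I A A' : Type*} [Fintype I] [DecidableEq I]

/-- The linear form `α_j ↦ c^a_{ij}` on `ℤ^I`. -/
def rowForm (C : CartanScheme I A) (i : I) (a : A) : Module.Dual ℤ (I → ℤ) :=
  LinearMap.proj i ∘ₗ (C.cartan a).mulVecLin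

theorem rowForm_simpleRoot (C : CartanScheme I A) (i j : I) (a : A) :
    C.rowForm i a (simpleRoot j) = C.cartan a i j := by
  simp [rowForm, simpleRoot]

/-- The automorphism `σ_i^a` of `ℤ^I`. -/
def sigma (C : CartanScheme I A) (i : I) (a : A) : (I → ℤ) ≃ₗ[ℤ] (I → ℤ) :=
  Module.reflection (x := simpleRoot i) (f := C.rowForm i a)
    ((C.rowForm_simpleRoot i i a).trans ((C.isGCM a).diag i))

/-- The defining formula `σ_i^a(α_j) = α_j - c^a_{ij} α_i`. -/
theorem sigma_simpleRoot (C : CartanScheme I A) (i j : I) (a : A) :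
    C.sigma i a (simpleRoot j) = simpleRoot j - C.cartan a i j • simpleRoot i := by
  rw [sigma, Module.reflection_apply, rowForm_simpleRoot]

/-- `C.wordObj [i_n, …, i_1] a` is the object `ρ_{i_n} ⋯ ρ_{i_1}(a)`. -/
def wordObj (C : CartanScheme I A) : List I → A → A
  | [], a => a
  | i :: w, a => C.rho i (wordObj C w a)

/-- `C.wordAut [i_n, …, i_1] a` is the automorphism
`σ_{i_n}^{ρ_{i_{n-1}} ⋯ ρ_{i_1}(a)} ⋯ σ_{i_2}^{ρ_{i_1}(a)} σ_{i_1}^a` of `ℤ^I`. -/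
def wordAut (C : CartanScheme I A) : List I → A → ((I → ℤ) ≃ₗ[ℤ] (I → ℤ))
  | [], _ => 1
  | i :: w, a => C.sigma i (C.wordObj w a) * wordAut C w a

/-- The morphisms from `a` to `b` in the Weyl groupoid of `C`: the triple `(b, f, a)` is a morphism
if and only if `f ∈ C.Hom a b`. -/
def Hom (C : CartanScheme I A) (a b : A) : Set ((I → ℤ) ≃ₗ[ℤ] (I → ℤ)) :=
  {f | ∃ w : List I, C.wordObj w a = b ∧ C.wordAut w a = f}

/-- The Weyl groupoid is connected. -/
def IsConnected (C : CartanScheme I A) : Prop :=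
  ∀ a b : A, (C.Hom a b).Nonempty

/-- Axiom (C3). -/
def SatisfiesC3 (C : CartanScheme I A) : Prop :=
  ∀ a b : A, (1 : (I → ℤ) ≃ₗ[ℤ] (I → ℤ)) ∈ C.Hom a b → a = b

/-- `π` is a covering `C' → C` of connected Cartan schemes. -/
structure IsCovering (C' : CartanScheme I A') (C : CartanScheme I A) (π : A' → A) : Prop where
  connected_source : C'.IsConnected
  connected_target : C.IsConnected
  cartan_eq : ∀ a', C.cartan (π a') = C'.cartan a'
  comm : ∀ i a', π (C'.rho i a') = C.rho i (π a')

/-- `S ∩ (ℕ₀ α_i + ℕ₀ α_j)` for a subset `S` of `ℤ^I`. -/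
def planePart (S : Set (I → ℤ)) (i j : I) : Set (I → ℤ) :=
  S ∩ {v | ∃ m n : ℕ, v = m • simpleRoot i + n • simpleRoot j}

/-- `S ∩ ℕ₀^I` for a subset `S` of `ℤ^I`. -/
def positivePart (S : Set (I → ℤ)) : Set (I → ℤ) :=
  S ∩ {v | ∀ k, 0 ≤ v k}

/-- The family `(R^a)_{a ∈ A}` of subsets of `ℤ^I` is a root system of type `C`. The number
`m^a_{i,j}` is the (possibly infinite) cardinality `(planePart (R a) i j).encard`. -/
structure IsRootSystem (C : CartanScheme I A) (R : A → Set (I → ℤ)) : Prop where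
  pos_neg : ∀ a, R a = positivePart (R a) ∪ -positivePart (R a)
  multiples : ∀ a i,
    R a ∩ {v | ∃ n : ℤ, v = n • simpleRoot i} = {simpleRoot i, -simpleRoot i}
  reflect : ∀ a i, C.sigma i a '' R a = R (C.rho i a)
  coxeter : ∀ (a : A) (i j : I) (m : ℕ), i ≠ j → (planePart (R a) i j).encard = m →
    (C.rho i ∘ C.rho j)^[m] a = a

end CartanScheme

/-! Axioms (R1)–(R3) pass directly through intersections over fibres and through pullback along `π`;
the content is (R4). Fix `i ≠ j` and count the positive roots of their plane made negative by an
alternating word in `i, j`. Each letter adds at most one such inversion, and exactly one as long as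
positive roots remain. So if the plane has `m` positive roots, the alternating word of length `m`
negates them all.

For (1), pull the intersection back to `C'`, where it lies inside `R'`. The word of length `m`
negates `α_i` and `α_j`, hence every positive plane root of `R'`; it has at most `m` inversions, so
both planes have `m` positive roots (`encard_planePart_eq_of_subset`). Then (R4) for `R'` projects
to `C`.

For (2), the word of length `2m` negates twice, so it permutes positive roots and acts as the
identity (`wordAut_altWord_eq_one`); (C3) turns this into equality of objects. -/

namespace CartanScheme

/-! ### Alternating words and reflections in a coordinate plane -/

section Words

variable {I A : Type*}

theorem wordObj_append (C : CartanScheme I A) (u w : List I) (a : A) :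
    C.wordObj (u ++ w) a = C.wordObj u (C.wordObj w a) := by
  induction u with
  | nil => rfl
  | cons i u ih => simp [wordObj, ih]

/-- The alternating word `[i, j, i, …]` of length `n`. -/
def altWord (i j : I) : ℕ → List I
  | 0 => []
  | n + 1 => i :: altWord j i n

theorem notMem_altWord {i j k : I} (hi : k ≠ i) (hj : k ≠ j) (n : ℕ) : k ∉ altWord i j n := by
  induction n generalizing i j with
  | zero => simp [altWord]
  | succ n ih => simpa [altWord, hi] using ih hj hi

/-- The parity of `m` decides which letter begins the second block; later arguments treat both cases
alike. -/
theorem altWord_add (i j : I) (m n : ℕ) :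
    altWord i j (m + n) = altWord i j m ++ altWord i j n ∨
      altWord i j (m + n) = altWord i j m ++ altWord j i n := by
  induction m generalizing i j with
  | zero => simp [altWord]
  | succ m ih =>
    rw [Nat.succ_add]
    rcases ih j i with h | h <;> simp [altWord, h]

theorem wordObj_altWord (C : CartanScheme I A) (i j : I) (m : ℕ) (a : A) :
    C.wordObj (altWord i j (m + m)) a = (C.rho i ∘ C.rho j)^[m] a := by
  induction m with
  | zero => rfl
  | succ m ih =>
    rw [Function.iterate_succ_apply', ← ih, show m + 1 + (m + 1) = m + m + 1 + 1 by omega]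
    rfl

/-- The determinant of the coordinates of two vectors in the plane spanned by `α_i`, `α_j`. -/
def planeDet (i j : I) (u v : I → ℤ) : ℤ := u i * v j - u j * v i

theorem planeDet_swap (i j : I) (u v : I → ℤ) : planeDet j i u v = -planeDet i j u v := by
  simp only [planeDet]; ring

theorem simpleRoot_nonneg [DecidableEq I] (i : I) : 0 ≤ simpleRoot i := by
  intro k
  by_cases hl : k = i <;> simp [simpleRoot, hl]

theorem simpleRoot_apply_of_ne [DecidableEq I] {i k : I} (h : k ≠ i) :
    simpleRoot i k = 0 := by
  simp [simpleRoot, h]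

theorem simpleRoot_ne_zero [DecidableEq I] (i : I) : simpleRoot i ≠ 0 := fun h => by
  simpa [simpleRoot] using congrFun h i

theorem eq_smul_add_smul [DecidableEq I] {i j : I} (hij : i ≠ j) {v : I → ℤ}
    (hv : ∀ k, k ≠ i → k ≠ j → v k = 0) : v = v i • simpleRoot i + v j • simpleRoot j := by
  funext k
  by_cases hi : k = i
  · subst hi; simp [simpleRoot, hij]
  by_cases hj : k = j
  · subst hj; simp [simpleRoot, hij.symm]
  simp [simpleRoot, hi, hj, hv k hi hj]

section Reflections

variable [Fintype I] [DecidableEq I] (C : CartanScheme I A)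

theorem sigma_apply (i : I) (a : A) (v : I → ℤ) :
    C.sigma i a v = v - C.rowForm i a v • simpleRoot i := by
  rw [sigma, Module.reflection_apply]

theorem sigma_apply_of_ne {i k : I} (h : k ≠ i) (a : A) (v : I → ℤ) :
    C.sigma i a v k = v k := by
  simp [sigma_apply, simpleRoot, h]

theorem sigma_sigma (i : I) (a : A) (v : I → ℤ) : C.sigma i a (C.sigma i a v) = v :=
  Module.involutive_reflection _ v

theorem sigma_simpleRoot_self (i : I) (a : A) :
    C.sigma i a (simpleRoot i) = -simpleRoot i :=
  Module.reflection_apply_self _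

theorem wordAut_cons_apply (i : I) (w : List I) (a : A) (v : I → ℤ) :
    C.wordAut (i :: w) a v = C.sigma i (C.wordObj w a) (C.wordAut w a v) := rfl

theorem wordAut_append (u w : List I) (a : A) :
    C.wordAut (u ++ w) a = C.wordAut u (C.wordObj w a) * C.wordAut w a := by
  induction u with
  | nil => simp [wordAut]
  | cons i u ih => simp [wordAut, ih, wordObj_append, mul_assoc]

theorem wordAut_apply_of_notMem {w : List I} {k : I} (h : k ∉ w) (a : A) (v : I → ℤ) :
    C.wordAut w a v k = v k := by
  induction w with
  | nil => rfl
  | cons i w ih =>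
    rw [List.mem_cons, not_or] at h
    rw [wordAut_cons_apply, sigma_apply_of_ne C h.1, ih h.2]

theorem rowForm_of_plane {i j : I} (hij : i ≠ j) (a : A) {v : I → ℤ}
    (hv : ∀ k, k ≠ i → k ≠ j → v k = 0) :
    C.rowForm i a v = 2 * v i + C.cartan a i j * v j := by
  conv_lhs => rw [eq_smul_add_smul hij hv]
  rw [map_add, map_smul, map_smul, rowForm_simpleRoot, rowForm_simpleRoot, (C.isGCM a).diag]
  simp only [smul_eq_mul]; ring

theorem planeDet_sigma {i j : I} (hij : i ≠ j) (a : A) {u v : I → ℤ}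
    (hu : ∀ k, k ≠ i → k ≠ j → u k = 0) (hv : ∀ k, k ≠ i → k ≠ j → v k = 0) :
    planeDet i j (C.sigma i a u) (C.sigma i a v) = -planeDet i j u v := by
  simp only [planeDet, sigma_apply_of_ne C hij.symm]
  simp only [sigma_apply, rowForm_of_plane C hij a hu, rowForm_of_plane C hij a hv, simpleRoot,
    Pi.sub_apply, Pi.smul_apply, Pi.single_eq_same, smul_eq_mul]
  ring

theorem planeDet_wordAut_altWord {i j : I} (hij : i ≠ j) (n : ℕ) (a : A) {u v : I → ℤ}
    (hu : ∀ k, k ≠ i → k ≠ j → u k = 0) (hv : ∀ k, k ≠ i → k ≠ j → v k = 0) :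
    planeDet i j (C.wordAut (altWord i j n) a u) (C.wordAut (altWord i j n) a v) =
      (-1) ^ n * planeDet i j u v := by
  induction n generalizing i j with
  | zero => simp [altWord, wordAut]
  | succ n ih =>
    have key {x : I → ℤ} (hx : ∀ k, k ≠ i → k ≠ j → x k = 0) :
        ∀ k, k ≠ i → k ≠ j → C.wordAut (altWord j i n) a x k = 0 := fun k hi hj => by
      rw [wordAut_apply_of_notMem C (notMem_altWord hj hi n), hx k hi hj]
    rw [altWord, wordAut_cons_apply, wordAut_cons_apply,
      planeDet_sigma C hij _ (key hu) (key hv), planeDet_swap,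
      ih hij.symm (fun k hi hj => hu k hj hi) (fun k hi hj => hv k hj hi), planeDet_swap i j]
    ring

end Reflections

end Words

/-- The root system axioms without the Coxeter relations. -/
structure IsWeakRootSystem {I A : Type*} [Fintype I] [DecidableEq I] (C : CartanScheme I A)
    (R : A → Set (I → ℤ)) : Prop where
  pos_neg : ∀ a, R a = positivePart (R a) ∪ -positivePart (R a)
  multiples : ∀ a i,
    R a ∩ {v | ∃ n : ℤ, v = n • simpleRoot i} = {simpleRoot i, -simpleRoot i}
  reflect : ∀ a i, C.sigma i a '' R a = R (C.rho i a)

theorem IsRootSystem.isWeakRootSystem {I A : Type*} [Fintype I] [DecidableEq I]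
    {C : CartanScheme I A} {R : A → Set (I → ℤ)} (h : C.IsRootSystem R) :
    C.IsWeakRootSystem R :=
  ⟨h.pos_neg, h.multiples, h.reflect⟩

theorem mem_planePart_iff {I : Type*} [Fintype I] [DecidableEq I] {i j : I} (hij : i ≠ j)
    {S : Set (I → ℤ)} {v : I → ℤ} :
    v ∈ planePart S i j ↔ v ∈ S ∧ 0 ≤ v ∧ ∀ k, k ≠ i → k ≠ j → v k = 0 := by
  refine and_congr_right fun _ => ⟨?_, ?_⟩
  · rintro ⟨m, n, rfl⟩
    refine ⟨fun k => ?_, fun k hi hj => by simp [simpleRoot, hi, hj]⟩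
    simp only [Pi.zero_apply, Pi.add_apply, Pi.smul_apply]
    exact add_nonneg (nsmul_nonneg (simpleRoot_nonneg i k) m) (nsmul_nonneg (simpleRoot_nonneg j k) n)
  · rintro ⟨h0, hv⟩
    refine ⟨(v i).toNat, (v j).toNat, ?_⟩
    rw [← natCast_zsmul, ← natCast_zsmul, Int.toNat_of_nonneg (h0 i), Int.toNat_of_nonneg (h0 j)]
    exact eq_smul_add_smul hij hv

theorem planePart_comm {I : Type*} [Fintype I] [DecidableEq I] {i j : I} (hij : i ≠ j)
    (S : Set (I → ℤ)) : planePart S i j = planePart S j i := by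
  ext v
  rw [mem_planePart_iff hij, mem_planePart_iff hij.symm]
  exact and_congr_right fun _ => and_congr_right fun _ =>
    ⟨fun h k hj hi => h k hi hj, fun h k hi hj => h k hj hi⟩

/-! ### Consequences of (R1)–(R3) -/

namespace IsWeakRootSystem

variable {I A : Type*} [Fintype I] [DecidableEq I] {C : CartanScheme I A} {R : A → Set (I → ℤ)}

theorem nonneg_or_nonpos (h : C.IsWeakRootSystem R) {a : A} {v : I → ℤ} (hv : v ∈ R a) :
    0 ≤ v ∨ v ≤ 0 := by
  rw [h.pos_neg a] at hv
  rcases hv with hv | hv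
  · exact Or.inl hv.2
  · exact Or.inr fun k => by simpa using hv.2 k

theorem neg_mem (h : C.IsWeakRootSystem R) {a : A} {v : I → ℤ} (hv : v ∈ R a) : -v ∈ R a := by
  rw [h.pos_neg a] at hv ⊢
  rcases hv with hv | hv
  · exact Or.inr (by simpa using hv)
  · exact Or.inl hv

theorem simpleRoot_mem (h : C.IsWeakRootSystem R) (a : A) (i : I) : simpleRoot i ∈ R a :=
  ((h.multiples a i).symm.subset (Or.inl rfl)).1

theorem eq_simpleRoot (h : C.IsWeakRootSystem R) {a : A} {v : I → ℤ} {i : I} (hv : v ∈ R a)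
    (h0 : 0 ≤ v) (hi : ∀ k, k ≠ i → v k = 0) : v = simpleRoot i := by
  have hvi : v = v i • simpleRoot i := by
    funext k
    by_cases hk : k = i
    · subst hk; simp [simpleRoot]
    · simp [simpleRoot, hk, hi k hk]
  rcases (h.multiples a i).subset ⟨hv, v i, hvi⟩ with e | e
  · exact e
  · have := h0 i
    rw [e] at this
    simp [simpleRoot] at this

theorem ne_zero (h : C.IsWeakRootSystem R) [Nonempty I] {a : A} {v : I → ℤ} (hv : v ∈ R a) :
    v ≠ 0 := by
  rintro rfl
  obtain ⟨i⟩ := ‹Nonempty I›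
  exact simpleRoot_ne_zero i (h.eq_simpleRoot hv le_rfl fun _ _ => rfl).symm

theorem sigma_mem_iff (h : C.IsWeakRootSystem R) {a : A} {i : I} {v : I → ℤ} :
    C.sigma i a v ∈ R (C.rho i a) ↔ v ∈ R a := by
  rw [← h.reflect a i]
  exact (C.sigma i a).injective.mem_set_image

theorem wordAut_mem_iff (h : C.IsWeakRootSystem R) (w : List I) {a : A} {v : I → ℤ} :
    C.wordAut w a v ∈ R (C.wordObj w a) ↔ v ∈ R a := by
  induction w with
  | nil => rfl
  | cons i w ih => rw [wordAut_cons_apply, wordObj, h.sigma_mem_iff, ih]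

theorem wordAut_symm_mem (h : C.IsWeakRootSystem R) (w : List I) {a : A} {v : I → ℤ}
    (hv : v ∈ R (C.wordObj w a)) : (C.wordAut w a).symm v ∈ R a := by
  rw [← h.wordAut_mem_iff w, LinearEquiv.apply_symm_apply]
  exact hv

theorem simpleRoot_mem_planePart_left (h : C.IsWeakRootSystem R) (a : A) {i j : I} (hij : i ≠ j) :
    simpleRoot i ∈ planePart (R a) i j :=
  (mem_planePart_iff hij).2
    ⟨h.simpleRoot_mem a i, simpleRoot_nonneg i, fun _ hi _ => simpleRoot_apply_of_ne hi⟩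

theorem simpleRoot_mem_planePart_right (h : C.IsWeakRootSystem R) (a : A) {i j : I} (hij : i ≠ j) :
    simpleRoot j ∈ planePart (R a) i j :=
  planePart_comm hij (R a) ▸ h.simpleRoot_mem_planePart_left a hij.symm

/-- A simple reflection permutes the other positive roots of a plane containing its root. -/
theorem sigma_nonneg (h : C.IsWeakRootSystem R) {a : A} {i j : I} (hij : i ≠ j) {v : I → ℤ}
    (hv : v ∈ planePart (R a) i j) (hne : v ≠ simpleRoot i) : 0 ≤ C.sigma i a v := by
  rw [mem_planePart_iff hij] at hv
  obtain ⟨hR, h0, hs⟩ := hv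
  refine (h.nonneg_or_nonpos (h.sigma_mem_iff.2 hR)).resolve_right fun hn => hne ?_
  -- The reflection leaves the `j`-coordinate alone, so a nonpositive image forces it to vanish and
  -- puts `v` on the line of `α_i`.
  have hj := hn j
  rw [sigma_apply_of_ne C hij.symm] at hj
  refine h.eq_simpleRoot hR h0 fun k hk => ?_
  by_cases hkj : k = j
  · subst hkj; exact le_antisymm hj (h0 k)
  · exact hs k hk hkj

/-! ### Counting inversions of alternating words -/

/-- The roots of a plane which are made negative by the alternating word of length `n`. -/
def inversions (C : CartanScheme I A) (R : A → Set (I → ℤ)) (a : A) (i j : I) (n : ℕ) :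
    Set (I → ℤ) :=
  {v | v ∈ planePart (R a) i j ∧ C.wordAut (altWord i j n) a v ≤ 0}

theorem wordAut_altWord_plane (C : CartanScheme I A) {i j : I} (n : ℕ) (a : A) {v : I → ℤ}
    (hv : ∀ k, k ≠ i → k ≠ j → v k = 0) :
    ∀ k, k ≠ i → k ≠ j → C.wordAut (altWord i j n) a v k = 0 := fun k hi hj => by
  rw [wordAut_apply_of_notMem C (notMem_altWord hi hj n), hv k hi hj]

theorem wordAut_symm_altWord_plane (C : CartanScheme I A) {i j : I} (n : ℕ) (a : A) {v : I → ℤ}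
    (hv : ∀ k, k ≠ i → k ≠ j → v k = 0) :
    ∀ k, k ≠ i → k ≠ j → (C.wordAut (altWord i j n) a).symm v k = 0 := fun k hi hj => by
  rw [← wordAut_apply_of_notMem C (notMem_altWord hi hj n) a ((C.wordAut _ a).symm v),
    LinearEquiv.apply_symm_apply, hv k hi hj]

/-- The added outer letter `i` makes no positive plane root negative except `α_i`, so the only
possible new inversion is the preimage of `α_i`. -/
theorem inversions_succ_subset (h : C.IsWeakRootSystem R) (a : A) {i j : I} (hij : i ≠ j) (n : ℕ) :
    inversions C R a i j (n + 1) ⊆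
      insert ((C.wordAut (altWord j i n) a).symm (simpleRoot i)) (inversions C R a j i n) := by
  have : Nonempty I := ⟨i⟩
  rintro v ⟨hv, hneg⟩
  by_contra hcon
  rw [Set.mem_insert_iff, not_or, LinearEquiv.eq_symm_apply] at hcon
  obtain ⟨hne, hN⟩ := hcon
  have hv' := (mem_planePart_iff hij).1 hv
  have hmem := (h.wordAut_mem_iff (altWord j i n)).2 hv'.1
  rcases h.nonneg_or_nonpos hmem with hp | hp
  · have hpl : C.wordAut (altWord j i n) a v ∈
        planePart (R (C.wordObj (altWord j i n) a)) i j :=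
      (mem_planePart_iff hij).2 ⟨hmem, hp, fun k hi hj =>
        wordAut_altWord_plane C n a (fun k hj hi => hv'.2.2 k hi hj) k hj hi⟩
    have := h.sigma_nonneg hij hpl hne
    exact h.ne_zero (h.sigma_mem_iff.2 hmem) (le_antisymm hneg this)
  · exact hN ⟨planePart_comm hij (R a) ▸ hv, hp⟩

theorem encard_inversions_le (h : C.IsWeakRootSystem R) (a : A) {i j : I} (hij : i ≠ j) (n : ℕ) :
    (inversions C R a i j n).encard ≤ n := by
  induction n generalizing i j with
  | zero =>
    have : Nonempty I := ⟨i⟩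
    rw [Nat.cast_zero, nonpos_iff_eq_zero, Set.encard_eq_zero, Set.eq_empty_iff_forall_notMem]
    rintro v ⟨hv, hn⟩
    rw [mem_planePart_iff hij] at hv
    exact h.ne_zero hv.1 (le_antisymm hn hv.2.1)
  | succ n ih =>
    refine (Set.encard_le_encard (h.inversions_succ_subset a hij n)).trans
      ((Set.encard_insert_le _ _).trans ?_)
    rw [Nat.cast_succ]
    gcongr
    exact ih hij.symm

/-- No axiom on `R` is needed, so negativity of the two images, established with one root system,
can be used for another. -/
theorem inversions_eq_of_simpleRoot {a : A} {i j : I} {n : ℕ}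
    (hi : C.wordAut (altWord i j n) a (simpleRoot i) ≤ 0)
    (hj : C.wordAut (altWord i j n) a (simpleRoot j) ≤ 0) :
    inversions C R a i j n = planePart (R a) i j := by
  refine Set.Subset.antisymm (fun v hv => hv.1) fun v hv => ⟨hv, ?_⟩
  obtain ⟨-, m, k, rfl⟩ := hv
  rw [map_add, map_nsmul, map_nsmul]
  exact add_nonpos (nsmul_nonpos hi m) (nsmul_nonpos hj k)

/-- If the inverse of the alternating word makes both simple roots negative, then the word makes
all positive roots of the plane negative. -/
theorem inversions_eq_of_symm_simpleRoot (h : C.IsWeakRootSystem R) {a : A} {i j : I}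
    (hij : i ≠ j) {n : ℕ}
    (hi : (C.wordAut (altWord i j n) a).symm (simpleRoot i) ≤ 0)
    (hj : (C.wordAut (altWord i j n) a).symm (simpleRoot j) ≤ 0) :
    inversions C R a i j n = planePart (R a) i j := by
  have : Nonempty I := ⟨i⟩
  refine Set.Subset.antisymm (fun v hv => hv.1) fun v hv => ⟨hv, ?_⟩
  rw [mem_planePart_iff hij] at hv
  refine (h.nonneg_or_nonpos ((h.wordAut_mem_iff _).2 hv.1)).resolve_left fun hp => ?_
  refine h.ne_zero hv.1 (le_antisymm ?_ hv.2.1)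
  have e := eq_smul_add_smul hij (wordAut_altWord_plane C n a hv.2.2)
  rw [← (C.wordAut (altWord i j n) a).symm_apply_apply v, e, map_add, map_smul, map_smul]
  exact add_nonpos (smul_nonpos_of_nonneg_of_nonpos (hp i) hi)
    (smul_nonpos_of_nonneg_of_nonpos (hp j) hj)

/-- The second clause drives the induction: the inverse of the shorter word already makes `α_j`
negative. If it also made `α_i` negative, all `m` positive roots would be inverted, contradicting `n
< m`. Hence the preimage of `α_i` is positive and is a genuinely new inversion. -/
theorem encard_inversions (h : C.IsWeakRootSystem R) {a : A} {i j : I} (hij : i ≠ j) {m : ℕ}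
    (hm : (planePart (R a) i j).encard = m) {n : ℕ} (hn : n ≤ m) :
    (inversions C R a i j n).encard = n ∧
      (n ≠ 0 → (C.wordAut (altWord i j n) a).symm (simpleRoot i) ≤ 0) := by
  induction n generalizing i j with
  | zero => exact ⟨nonpos_iff_eq_zero.1 (h.encard_inversions_le a hij 0), fun h => (h rfl).elim⟩
  | succ n ih =>
    have : Nonempty I := ⟨i⟩
    rw [planePart_comm hij] at hm
    obtain ⟨hcard, hneg⟩ := ih hij.symm hm (by omega)
    set f := C.wordAut (altWord j i n) a with hf
    have hβ : f.symm (simpleRoot i) ∈ R a :=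
      h.wordAut_symm_mem _ (h.simpleRoot_mem _ i)
    have hpos : 0 ≤ f.symm (simpleRoot i) := by
      refine (h.nonneg_or_nonpos hβ).resolve_right fun hi => ?_
      rcases eq_or_ne n 0 with rfl | h0
      · exact simpleRoot_ne_zero i (le_antisymm hi (simpleRoot_nonneg i))
      · have := h.inversions_eq_of_symm_simpleRoot hij.symm (hneg h0) hi
        rw [this, hm] at hcard
        have : m = n := by exact_mod_cast hcard
        omega
    have hplane : f.symm (simpleRoot i) ∈ planePart (R a) i j :=
      (mem_planePart_iff hij).2 ⟨hβ, hpos, fun k hi hj =>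
        wordAut_symm_altWord_plane C n a (fun k _ hi => simpleRoot_apply_of_ne hi) k hj hi⟩
    have hσ (v : I → ℤ) : C.wordAut (altWord i j (n + 1)) a v =
      C.sigma i (C.wordObj (altWord j i n) a) (f v) := rfl
    have heq : inversions C R a i j (n + 1) =
        insert (f.symm (simpleRoot i)) (inversions C R a j i n) := by
      refine (h.inversions_succ_subset a hij n).antisymm (Set.insert_subset ?_ ?_)
      · refine ⟨hplane, ?_⟩
        rw [hσ, LinearEquiv.apply_symm_apply, sigma_simpleRoot_self]
        exact neg_nonpos.2 (simpleRoot_nonneg i)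
      · rintro v ⟨hv, hvn⟩
        refine ⟨planePart_comm hij (R a) ▸ hv, ?_⟩
        rw [mem_planePart_iff hij.symm] at hv
        have hmem : -f v ∈ planePart (R (C.wordObj (altWord j i n) a)) i j := by
          refine (mem_planePart_iff hij).2 ⟨h.neg_mem ((h.wordAut_mem_iff _).2 hv.1),
            neg_nonneg.2 hvn, fun k hi hj => ?_⟩
          rw [Pi.neg_apply, wordAut_altWord_plane C n a hv.2.2 k hj hi, neg_zero]
        -- Equality would make `-v` the preimage of `α_i`, which is positive, although `v` is a
        -- positive root.
        have hne : -f v ≠ simpleRoot i := fun e => by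
          rw [← e, map_neg, LinearEquiv.symm_apply_apply, neg_nonneg] at hpos
          exact h.ne_zero hv.1 (le_antisymm hpos hv.2.1)
        have := h.sigma_nonneg hij hmem hne
        rwa [map_neg, neg_nonneg] at this
    refine ⟨?_, fun _ => ?_⟩
    · rw [heq, Set.encard_insert_of_notMem, hcard, Nat.cast_succ]
      rintro ⟨-, hn⟩
      rw [← hf, LinearEquiv.apply_symm_apply] at hn
      exact simpleRoot_ne_zero i (le_antisymm hn (simpleRoot_nonneg i))
    · have e : (C.wordAut (altWord i j (n + 1)) a).symm (simpleRoot i) =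
          -f.symm (simpleRoot i) := by
        rw [LinearEquiv.symm_apply_eq, hσ, map_neg, LinearEquiv.apply_symm_apply, map_neg,
          sigma_simpleRoot_self, neg_neg]
      rw [e]
      exact neg_nonpos.2 hpos

/-- If the plane has `m` positive roots, then the alternating words of length `m` make all of them
negative. -/
theorem wordAut_altWord_nonpos (h : C.IsWeakRootSystem R) {a : A} {i j : I} (hij : i ≠ j) {m : ℕ}
    (hm : (planePart (R a) i j).encard = m) {v : I → ℤ} (hv : v ∈ planePart (R a) i j) :
    C.wordAut (altWord i j m) a v ≤ 0 := by
  have hfin : (planePart (R a) i j).Finite := Set.finite_of_encard_eq_coe hm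
  have : inversions C R a i j m = planePart (R a) i j :=
    hfin.eq_of_subset_of_encard_le' (fun v hv => hv.1)
      (by rw [hm, (h.encard_inversions hij hm le_rfl).1])
  rw [← this] at hv
  exact hv.2

/-- The smaller system shows that the word of length `m` negates both simple roots; the larger one
then has only inversions in this plane, hence at most `m`. -/
theorem encard_planePart_eq_of_subset {R' : A → Set (I → ℤ)} (h : C.IsWeakRootSystem R)
    (h' : C.IsWeakRootSystem R') {a : A} (hsub : R a ⊆ R' a) {i j : I} (hij : i ≠ j) {m : ℕ}
    (hm : (planePart (R a) i j).encard = m) : (planePart (R' a) i j).encard = m := by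
  refine le_antisymm ?_ (hm ▸ Set.encard_le_encard fun v hv => ⟨hsub hv.1, hv.2⟩)
  rw [← inversions_eq_of_simpleRoot (C := C)
    (h.wordAut_altWord_nonpos hij hm (h.simpleRoot_mem_planePart_left a hij))
    (h.wordAut_altWord_nonpos hij hm (h.simpleRoot_mem_planePart_right a hij))]
  exact h'.encard_inversions_le a hij m

/-! ### Coxeter relations for automorphisms -/

theorem bijOn_neg_wordAut (h : C.IsWeakRootSystem R) {a : A} {i j : I} (hij : i ≠ j) {m : ℕ}
    (hm : (planePart (R a) i j).encard = m) :
    Set.BijOn (fun v => -C.wordAut (altWord i j m) a v) (planePart (R a) i j)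
      (planePart (R (C.wordObj (altWord i j m) a)) i j) := by
  have : Nonempty I := ⟨i⟩
  refine ⟨fun v hv => ?_, fun u _ v _ e => (C.wordAut _ a).injective (neg_injective e),
    fun v hv => ?_⟩
  · have hn := h.wordAut_altWord_nonpos hij hm hv
    rw [mem_planePart_iff hij] at hv ⊢
    refine ⟨h.neg_mem ((h.wordAut_mem_iff _).2 hv.1), neg_nonneg.2 hn, fun k hi hj => ?_⟩
    exact neg_eq_zero.2 (wordAut_altWord_plane C m a hv.2.2 k hi hj)
  · rw [mem_planePart_iff hij] at hv
    have hR := h.wordAut_symm_mem _ hv.1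
    have hs := wordAut_symm_altWord_plane C m a hv.2.2
    refine ⟨-(C.wordAut (altWord i j m) a).symm v, (mem_planePart_iff hij).2
      ⟨h.neg_mem hR, ?_, fun k hi hj => by rw [Pi.neg_apply, hs k hi hj, neg_zero]⟩, by simp⟩
    refine neg_nonneg.2 ((h.nonneg_or_nonpos hR).resolve_left fun hp => ?_)
    have := h.wordAut_altWord_nonpos hij hm ((mem_planePart_iff hij).2 ⟨hR, hp, hs⟩)
    rw [LinearEquiv.apply_symm_apply] at this
    exact h.ne_zero hv.1 (le_antisymm this hv.2.1)

theorem bijOn_wordAut (h : C.IsWeakRootSystem R) {a : A} {i j : I} (hij : i ≠ j) {m : ℕ}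
    (hm : (planePart (R a) i j).encard = m) :
    Set.BijOn (C.wordAut (altWord i j (m + m)) a) (planePart (R a) i j)
      (planePart (R (C.wordObj (altWord i j (m + m)) a)) i j) := by
  have key {k l : I} (hkl : k ≠ l) (hp : ∀ S : Set (I → ℤ), planePart S i j = planePart S k l)
      (e : altWord i j (m + m) = altWord i j m ++ altWord k l m) :
      Set.BijOn (C.wordAut (altWord i j (m + m)) a) (planePart (R a) i j)
        (planePart (R (C.wordObj (altWord i j (m + m)) a)) i j) := by
    have h₁ := h.bijOn_neg_wordAut hkl (hp (R a) ▸ hm)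
    rw [← hp, ← hp] at h₁
    have hm' : (planePart (R (C.wordObj (altWord k l m) a)) i j).encard = m := by
      rw [← h₁.image_eq, h₁.injOn.encard_image, hm]
    have h₂ := (h.bijOn_neg_wordAut hij hm').comp h₁
    rw [e, wordObj_append, wordAut_append]
    exact h₂.congr fun v _ => by simp
  rcases altWord_add i j m m with e | e
  · exact key hij (fun _ => rfl) e
  · exact key hij.symm (planePart_comm hij) e

/-- The Coxeter relation of a plane with finitely many roots, at the level of automorphisms. -/
theorem wordAut_altWord_eq_one (h : C.IsWeakRootSystem R) {a : A} {i j : I} (hij : i ≠ j) {m : ℕ}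
    (hm : (planePart (R a) i j).encard = m) : C.wordAut (altWord i j (m + m)) a = 1 := by
  have hbij := h.bijOn_wordAut hij hm
  have hdet := C.planeDet_wordAut_altWord hij (m + m) a (u := simpleRoot i) (v := simpleRoot j)
    (fun k hi _ => simpleRoot_apply_of_ne hi) (fun k _ hj => simpleRoot_apply_of_ne hj)
  have hmem (v : I → ℤ) := h.wordAut_mem_iff (altWord i j (m + m)) (a := a) (v := v)
  have hout (v : I → ℤ) (k : I) (hi : k ≠ i) (hj : k ≠ j) :=
    C.wordAut_apply_of_notMem (notMem_altWord hi hj (m + m)) a v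
  set f := C.wordAut (altWord i j (m + m)) a with hf
  set b := C.wordObj (altWord i j (m + m)) a with hb
  have hui := (mem_planePart_iff hij).1 (hbij.mapsTo (h.simpleRoot_mem_planePart_left a hij))
  have huj := (mem_planePart_iff hij).1 (hbij.mapsTo (h.simpleRoot_mem_planePart_right a hij))
  have ei := eq_smul_add_smul hij hui.2.2
  have ej := eq_smul_add_smul hij huj.2.2
  set p := f (simpleRoot i) i
  set r := f (simpleRoot i) j
  set q := f (simpleRoot j) i
  set s := f (simpleRoot j) j
  have hp : 0 ≤ p := hui.2.1 i
  have hr : 0 ≤ r := hui.2.1 j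
  have hq : 0 ≤ q := huj.2.1 i
  have hs : 0 ≤ s := huj.2.1 j
  have hdet' : p * s - r * q = 1 := by
    rw [← two_mul, pow_mul, neg_one_sq, one_pow, one_mul] at hdet
    exact hdet.trans (by simp [planeDet, simpleRoot, hij])
  have inv_nonneg {v w : I → ℤ} (hv : v ∈ planePart (R b) i j) (hw : f w = v) : 0 ≤ w := by
    obtain ⟨w', hw', e⟩ := hbij.surjOn hv
    rw [← hw] at e
    rw [← f.injective e]
    exact ((mem_planePart_iff hij).1 hw').2.1
  -- On the plane `f` has nonnegative entries and determinant 1. The witnesses here and for `q` are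
  -- the columns of its inverse, whose off-diagonal entries `-r`, `-q` must also be nonnegative.
  have hr0 : r = 0 := by
    have := inv_nonneg (w := s • simpleRoot i - r • simpleRoot j)
      (h.simpleRoot_mem_planePart_left b hij) (by
        rw [map_sub, map_smul, map_smul, ei, ej]
        exact Eq.trans (b := (p * s - r * q) • simpleRoot i) (by module)
          (by rw [hdet', one_smul])) j
    simp [simpleRoot, hij.symm] at this
    omega
  have hq0 : q = 0 := by
    have := inv_nonneg (w := p • simpleRoot j - q • simpleRoot i)
      (h.simpleRoot_mem_planePart_right b hij) (by
        rw [map_sub, map_smul, map_smul, ei, ej]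
        exact Eq.trans (b := (p * s - r * q) • simpleRoot j) (by module)
          (by rw [hdet', one_smul])) i
    simp [simpleRoot, hij] at this
    omega
  have hps : p * s = 1 := by rw [← hdet', hr0]; ring
  have hp1 : p = 1 := Int.eq_one_of_mul_eq_one_right hp hps
  have hs1 : s = 1 := by rwa [hp1, one_mul] at hps
  rw [hp1, hr0, one_smul, zero_smul, add_zero] at ei
  rw [hq0, hs1, one_smul, zero_smul, zero_add] at ej
  have key (k : I) : f (simpleRoot k) = simpleRoot k := by
    by_cases hi : k = i
    · rw [hi, ei]
    by_cases hj : k = j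
    · rw [hj, ej]
    have hpos {c : A} {v : I → ℤ} (hv : v ∈ R c) (hk : v k = 1) : 0 ≤ v :=
      (h.nonneg_or_nonpos hv).resolve_right fun hn => by
        have := hn k
        rw [hk] at this
        exact absurd this (by simp)
    have hv := (hmem (simpleRoot k)).2 (h.simpleRoot_mem a k)
    have h0 := hpos hv (by rw [hout _ k hi hj]; simp [simpleRoot])
    have e₁ : f (simpleRoot k) - simpleRoot k =
        f (simpleRoot k) i • simpleRoot i + f (simpleRoot k) j • simpleRoot j := by
      have := eq_smul_add_smul hij (v := f (simpleRoot k) - simpleRoot k) fun l hli hlj => by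
        rw [Pi.sub_apply, hout _ l hli hlj, sub_self]
      rwa [Pi.sub_apply, Pi.sub_apply, simpleRoot_apply_of_ne (Ne.symm hi),
        simpleRoot_apply_of_ne (Ne.symm hj), sub_zero, sub_zero] at this
    set x := f (simpleRoot k) i
    set y := f (simpleRoot k) j
    have hx : 0 ≤ x := h0 i
    have hy : 0 ≤ y := h0 j
    -- For `k` outside the plane, `f α_k = α_k + x α_i + y α_j` with `x, y ≥ 0`. The preimage of
    -- `α_k` is a root with `k`-coordinate 1, hence positive, which forces `x = y = 0`.
    have e₂ : f (simpleRoot k - x • simpleRoot i - y • simpleRoot j) = simpleRoot k := by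
      rw [map_sub, map_sub, map_smul, map_smul, ei, ej, sub_sub, ← e₁, sub_sub_cancel]
    have h1 := hpos (c := a) ((hmem _).1 (e₂ ▸ h.simpleRoot_mem b k))
      (by simp [simpleRoot, hi, hj])
    have hx' := h1 i
    have hy' := h1 j
    simp [simpleRoot, hij, Ne.symm hi] at hx'
    simp [simpleRoot, hij.symm, Ne.symm hj] at hy'
    rw [le_antisymm hx' hx, le_antisymm hy' hy, zero_smul, zero_smul, add_zero, sub_eq_zero] at e₁
    exact e₁
  refine LinearEquiv.toLinearMap_injective (LinearMap.pi_ext' fun k => LinearMap.ext_ring ?_)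
  exact key k

theorem isRootSystem_of_satisfiesC3 (h : C.IsWeakRootSystem R) (h3 : C.SatisfiesC3) :
    C.IsRootSystem R where
  pos_neg := h.pos_neg
  multiples := h.multiples
  reflect := h.reflect
  coxeter a i j m hij hm := by
    refine (h3 a _ ⟨altWord i j (m + m), C.wordObj_altWord i j m a, ?_⟩).symm
    exact h.wordAut_altWord_eq_one hij hm

end IsWeakRootSystem

/-! ### Transfer along coverings -/

namespace IsCovering

variable {I A A' : Type*} [Fintype I] [DecidableEq I] {C : CartanScheme I A}
  {C' : CartanScheme I A'} {π : A' → A}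

theorem sigma_eq (hπ : C'.IsCovering C π) (i : I) (a' : A') :
    C.sigma i (π a') = C'.sigma i a' := by
  ext1 v
  rw [sigma_apply, sigma_apply, rowForm, rowForm, hπ.cartan_eq]

theorem wordObj_eq (hπ : C'.IsCovering C π) (w : List I) (a' : A') :
    C.wordObj w (π a') = π (C'.wordObj w a') := by
  induction w with
  | nil => rfl
  | cons i w ih => rw [wordObj, wordObj, ih, hπ.comm]

theorem surjective (hπ : C'.IsCovering C π) : Function.Surjective π := fun a => by
  obtain ⟨a'⟩ := C'.nonempty_obj
  obtain ⟨_, w, hw, -⟩ := hπ.connected_target (π a') a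
  exact ⟨C'.wordObj w a', by rw [← hπ.wordObj_eq, hw]⟩

theorem isWeakRootSystem_comp (hπ : C'.IsCovering C π) {R : A → Set (I → ℤ)}
    (h : C.IsWeakRootSystem R) : C'.IsWeakRootSystem fun a' => R (π a') where
  pos_neg a' := h.pos_neg (π a')
  multiples a' i := h.multiples (π a') i
  reflect a' i := by rw [← hπ.sigma_eq, h.reflect, hπ.comm]

theorem isWeakRootSystem_iInter (hπ : C'.IsCovering C π) {R' : A' → Set (I → ℤ)}
    (h : C'.IsWeakRootSystem R') :
    C.IsWeakRootSystem fun a => ⋂ a' ∈ {x : A' | π x = a}, R' a' where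
  pos_neg a := by
    obtain ⟨b, hb⟩ := hπ.surjective a
    have hneg {v : I → ℤ} (hv : v ∈ ⋂ a' ∈ {x : A' | π x = a}, R' a') :
        -v ∈ ⋂ a' ∈ {x : A' | π x = a}, R' a' := by
      simp only [Set.mem_iInter] at hv ⊢
      exact fun a' ha' => h.neg_mem (hv a' ha')
    ext v
    constructor
    · intro hv
      rcases h.nonneg_or_nonpos (Set.mem_iInter₂.1 hv b hb) with h0 | h0
      · exact Or.inl ⟨hv, h0⟩
      · exact Or.inr ⟨hneg hv, neg_nonneg.2 h0⟩
    · rintro (hv | hv)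
      · exact hv.1
      · simpa using hneg hv.1
  multiples a i := by
    obtain ⟨b, hb⟩ := hπ.surjective a
    ext v
    constructor
    · rintro ⟨hv, hn⟩
      exact (h.multiples b i).subset ⟨Set.mem_iInter₂.1 hv b hb, hn⟩
    · intro hv
      exact ⟨Set.mem_iInter₂.2 fun a' _ => ((h.multiples a' i).symm.subset hv).1,
        ((h.multiples b i).symm.subset hv).2⟩
  reflect a i := by
    have hmap {a : A} {v : I → ℤ} (hv : v ∈ ⋂ a' ∈ {x : A' | π x = a}, R' a') :
        C.sigma i a v ∈ ⋂ a' ∈ {x : A' | π x = C.rho i a}, R' a' := by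
      refine Set.mem_iInter₂.2 fun a' ha' => ?_
      have hb : π (C'.rho i a') = a := by rw [hπ.comm, ha', C.rho_rho]
      have := h.sigma_mem_iff (i := i).2 (Set.mem_iInter₂.1 hv _ hb)
      rwa [C'.rho_rho, ← hπ.sigma_eq, hb] at this
    -- The Cartan matrix is unchanged by `ρ_i`, so the reflection back is the same involution and
    -- the inclusion just shown also gives its converse.
    have hσ (v : I → ℤ) : C.sigma i (C.rho i a) v = C.sigma i a v := by
      simp [sigma_apply, rowForm, Matrix.mulVec, dotProduct, C.cartan_rho]
    refine Set.Subset.antisymm (Set.image_subset_iff.2 fun v hv => hmap hv) fun v hv => ?_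
    refine ⟨C.sigma i a v, ?_, C.sigma_sigma i a v⟩
    have := hmap hv
    rwa [hσ, C.rho_rho] at this

theorem iterate_eq (hπ : C'.IsCovering C π) (i j : I) (m : ℕ) (a' : A') :
    π ((C'.rho i ∘ C'.rho j)^[m] a') = (C.rho i ∘ C.rho j)^[m] (π a') := by
  rw [← wordObj_altWord, ← wordObj_altWord, hπ.wordObj_eq]

theorem isRootSystem_iInter (hπ : C'.IsCovering C π) {R' : A' → Set (I → ℤ)}
    (h : C'.IsRootSystem R') : C.IsRootSystem fun a => ⋂ a' ∈ {x : A' | π x = a}, R' a' := by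
  have hw := hπ.isWeakRootSystem_iInter h.isWeakRootSystem
  refine ⟨hw.pos_neg, hw.multiples, hw.reflect, fun a i j m hij hm => ?_⟩
  obtain ⟨a', rfl⟩ := hπ.surjective a
  have hm' := (hπ.isWeakRootSystem_comp hw).encard_planePart_eq_of_subset h.isWeakRootSystem
    (Set.biInter_subset_of_mem (s := {x : A' | π x = π a'}) (t := R') rfl) hij hm
  rw [← hπ.iterate_eq, h.coxeter a' i j m hij hm']

end IsCovering

end CartanScheme

theorem mainTheorem11 {I A A' : Type*} [Fintype I] [DecidableEq I] [Nonempty I]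
    (C : CartanScheme I A) (C' : CartanScheme I A') (π : A' → A)
    (hπ : CartanScheme.IsCovering C' C π) :
    (∀ R' : A' → Set (I → ℤ), C'.IsRootSystem R' →
      C.IsRootSystem (fun a => ⋂ a' ∈ {x : A' | π x = a}, R' a')) ∧
    (∀ R : A → Set (I → ℤ), C.IsRootSystem R → C'.SatisfiesC3 →
      C'.IsRootSystem (fun a' => R (π a'))) :=
  ⟨fun _ h => hπ.isRootSystem_iInter h, fun _ h h3 =>
    (hπ.isWeakRootSystem_comp h.isWeakRootSystem).isRootSystem_of_satisfiesC3 h3⟩
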